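/- Let $H_0,\dots,H_M$ be Hermitian $D\times D$ complex matrices ($D\ge 1$), let $h_0,\dots,h_M$ be real-valued functions of time, let $T\ge 0$, and suppose that the Hamiltonian $H(t)=\sum_{m=0}^M h_m(t)H_m$ is piecewise continuous on $[0,T]$ (continuous outside a finite set, with finite one-sided limits everywhere). Let $U$ be a solution on $[0,T]$ of the Schrödinger equation $$ i\,\frac{d}{dt}U(t)=H(t)\,U(t),\qquad U(0)=I, $$ that is, $U$ is continuous on $[0,T]$ and satisfies the differential equation at all but finitely many $t\in[0,T]$. Let $\mathcal L(\{iH_m\})$ be the real Lie algebra of matrices generated by $iH_0,\dots,iH_M$ under the commutator, and for Hermitian $A$ let $\mathrm{dev}\,A\ge 0$ be given by $$ (\mathrm{dev}\,A)^2=\frac{\mathrm{tr}(A^2)}{D}-\Bigl(\frac{\mathrm{tr}A}{D}\Bigr)^2 . $$ Then there is a Hermitian matrix $C[T]$ such that $$ e^{-iC[T]}=U(T),\qquad iC[T]\in\mathcal L(\{iH_m\}),\qquad \mathrm{dev}\,C[T]\le\int_0^T \mathrm{dev}\,H(t)\,dt . $$ -/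

import Mathlib

open Set Filter Topology

attribute [local instance] LieRing.ofAssociativeRing

noncomputable section

namespace QuantumControl

/-- `f` is piecewise continuous on `[a, b]`: it is continuous there (one-sidedly at the end points)
outside a finite set, and it has finite one-sided limits everywhere. -/
def PiecewiseContinuousOn {E : Type*} [TopologicalSpace E] (f : ℝ → E) (a b : ℝ) : Prop :=
  (∃ S : Set ℝ, S.Finite ∧ ∀ t ∈ Icc a b \ S, ContinuousWithinAt f (Icc a b) t) ∧
  (∀ t ∈ Ico a b, ∃ l : E, Tendsto f (𝓝[>] t) (𝓝 l)) ∧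
  (∀ t ∈ Ioc a b, ∃ l : E, Tendsto f (𝓝[<] t) (𝓝 l))

/-- The Hamiltonian `H(t) = ∑ₘ hₘ(t) Hₘ`, `m = 0, …, M`, with real modulations `hₘ`. -/
def hamiltonian {D M : ℕ} (Hm : Fin (M + 1) → Matrix (Fin D) (Fin D) ℂ)
    (h : Fin (M + 1) → ℝ → ℝ) (t : ℝ) : Matrix (Fin D) (Fin D) ℂ :=
  ∑ m, h m t • Hm m

/-- `U` solves `i dU/dt = H(t) U(t)`, `U(0) = I` on `[0, T]`: it is continuous, and the equation
holds at all but finitely many times (at a jump of `H` a two-sided derivative need not exist). -/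
structure IsSchrodingerSolution {D : ℕ} (H U : ℝ → Matrix (Fin D) (Fin D) ℂ) (T : ℝ) : Prop where
  continuousOn : ContinuousOn U (Icc 0 T)
  equation : ∃ S : Set ℝ, S.Finite ∧ ∀ t ∈ Icc 0 T \ S,
    HasDerivWithinAt U ((-Complex.I) • (H t * U t)) (Icc 0 T) t
  initial : U 0 = 1

/-- The dynamical Lie algebra `𝓛({i Hₘ})`: the smallest real Lie algebra of matrices, with the
commutator as bracket, that contains all `i Hₘ`. -/
def dynamicalLieAlgebra {D M : ℕ} (Hm : Fin (M + 1) → Matrix (Fin D) (Fin D) ℂ) :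
    LieSubalgebra ℝ (Matrix (Fin D) (Fin D) ℂ) :=
  LieSubalgebra.lieSpan ℝ (Matrix (Fin D) (Fin D) ℂ) (range fun m => Complex.I • Hm m)

/-- The deviation of a Hermitian matrix, `(dev A)² = tr(A²)/D - (tr A/D)²`, `dev A ≥ 0`.
For Hermitian `A` the right-hand side is real and nonnegative. -/
def dev {D : ℕ} (A : Matrix (Fin D) (Fin D) ℂ) : ℝ :=
  Real.sqrt ((A * A).trace / (D : ℂ) - (A.trace / (D : ℂ)) ^ 2).re

end QuantumControl

end

section

attribute [-instance] LieRing.ofAssociativeRing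

namespace QuantumControl

/-! ### The exponential in a Banach algebra and its derivative. -/

section BanachAlgebra

open NormedSpace

variable {𝔸 : Type*} [NormedRing 𝔸] [NormedAlgebra ℝ 𝔸] [CompleteSpace 𝔸]

/-! Let V be the dynamical Lie algebra, which consists of skew-Hermitian matrices. The covariance
form β is invariant under conjugation, and `devNorm x = √(β x x)` turns -iA into dev A. Everything
rests on one fact, `exists_exp_eq_exp_mul_exp`: if β is positive definite on V, then exp x · exp y =
exp z with z in V and √β(z,z) ≤ √β(x,x) + √β(y,y).

This is a discrete geodesic argument. Write exp x · exp y as a product of many short factors exp xᵢ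
with xᵢ in V, and minimise the energy Σ β(xᵢ,xᵢ) over all tuples of the same length with the same
product. If two neighbours a ≠ b occur in a minimiser, moving a factor exp(ε(b - a)) from the second
exponential to the first changes the energy at rate -2β(b - a, b - a) < 0 (`exists_shorter_pair`).
Hence all n factors agree, the product is exp(na), and β(na,na) is n times the energy
(`exists_exp_eq_list_prod`). Pieces of almost equal length then give the triangle inequality in the
limit.

On skew-Hermitian matrices β degenerates exactly on the scalars; if V contains them they are split
off, being central and invisible to dev. Finally the evolution is followed by continuous induction
(`exists_exp_near_evolution`): a short step multiplies by an exponential on the left, subadditivity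
adds up the lengths, and the error is removed by compactness. -/

variable (𝔸) in
theorem continuous_exp : Continuous (exp : 𝔸 → 𝔸) :=
  let _ : NormedAlgebra ℚ 𝔸 := NormedAlgebra.restrictScalars ℚ ℝ 𝔸
  exp_continuous

theorem exp_neg_mul_exp (a : 𝔸) : exp (-a) * exp a = 1 := by
  let _ : NormedAlgebra ℚ 𝔸 := NormedAlgebra.restrictScalars ℚ ℝ 𝔸
  rw [← exp_add_of_commute (Commute.refl a).neg_left, neg_add_cancel, exp_zero]

theorem exp_mul_exp_neg (a : 𝔸) : exp a * exp (-a) = 1 := by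
  simpa using exp_neg_mul_exp (-a)

theorem exp_conj_exp (a x : 𝔸) : exp (exp (-a) * x * exp a) = exp (-a) * exp x * exp a := by
  let _ : NormedAlgebra ℚ 𝔸 := NormedAlgebra.restrictScalars ℚ ℝ 𝔸
  exact exp_units_conj ⟨exp (-a), exp a, exp_neg_mul_exp a, exp_mul_exp_neg a⟩ x

theorem exp_natCast_smul (n : ℕ) (a : 𝔸) : exp ((n : ℝ) • a) = exp a ^ n := by
  let _ : NormedAlgebra ℚ 𝔸 := NormedAlgebra.restrictScalars ℚ ℝ 𝔸
  rw [Nat.cast_smul_eq_nsmul, exp_nsmul]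

variable (𝔸) in
theorem contDiff_exp {n : WithTop ℕ∞} : ContDiff ℝ n (exp : 𝔸 → 𝔸) :=
  contDiff_iff_contDiffAt.2 fun x => (exp_analytic (𝕂 := ℝ) x).contDiffAt

/-- The derivative of the exponential, `exp (-a) * (D exp)(a) y = ∫₀¹ exp (-s a) y exp (s a) ds`. -/
theorem exp_neg_mul_fderiv_exp (a y : 𝔸) :
    exp (-a) * fderiv ℝ exp a y = ∫ s in (0 : ℝ)..1, exp (s • -a) * y * exp (s • a) := by
  have hc := continuous_exp 𝔸
  set J : ℝ → 𝔸 := fun ε => ∫ s in (0 : ℝ)..1, exp (s • -a) * y * exp (s • (a + ε • y)) with hJ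
  have hJc : Continuous J := by
    apply intervalIntegral.continuous_parametric_intervalIntegral_of_continuous'
    fun_prop
  -- The integrand ε · exp(-sa) y exp(s(a + εy)) is the s-derivative of exp(-sa) exp(s(a + εy)), so
  -- this holds exactly for every ε, not only to first order.
  have key : ∀ ε : ℝ, exp (-a) * exp (a + ε • y) - 1 = ε • J ε := by
    intro ε
    have hd : ∀ s : ℝ, HasDerivAt (fun s : ℝ => exp (s • -a) * exp (s • (a + ε • y)))
        (ε • (exp (s • -a) * y * exp (s • (a + ε • y)))) s := by
      intro s
      refine ((hasDerivAt_exp_smul_const (-a) s).fun_mul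
        (hasDerivAt_exp_smul_const' (a + ε • y) s)).congr_deriv ?_
      rw [← smul_mul_assoc, ← mul_smul_comm]
      noncomm_ring
    have := intervalIntegral.integral_eq_sub_of_hasDerivAt (a := 0) (b := 1) (fun s _ => hd s)
      (Continuous.intervalIntegrable (by fun_prop) _ _)
    rw [intervalIntegral.integral_smul] at this
    simp only [one_smul, zero_smul, exp_zero, mul_one] at this
    exact this.symm
  have h1 : HasDerivAt (fun ε : ℝ => exp (-a) * exp (a + ε • y)) (J 0) 0 := by
    rw [hasDerivAt_iff_tendsto_slope]
    refine (hJc.tendsto 0 |>.mono_left nhdsWithin_le_nhds).congr' ?_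
    filter_upwards [self_mem_nhdsWithin] with ε hε
    have hε : ε ≠ 0 := hε
    have h0 := key 0
    rw [zero_smul, zero_smul, sub_eq_zero] at h0
    simp only [slope, vsub_eq_sub, sub_zero, zero_smul, h0, key ε]
    rw [smul_smul, inv_mul_cancel₀ hε, one_smul]
  have h2 : HasDerivAt (fun ε : ℝ => exp (-a) * exp (a + ε • y)) (exp (-a) * fderiv ℝ exp a y) 0 := by
    have hl : HasDerivAt (fun ε : ℝ => a + ε • y) y 0 := by
      simpa using ((hasDerivAt_id (0 : ℝ)).smul_const y).const_add a
    have hf : HasFDerivAt exp (fderiv ℝ exp a) (a + (0 : ℝ) • y) := by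
      rw [zero_smul, add_zero]
      exact ((contDiff_exp 𝔸 (n := 1)).differentiable (by norm_num) a).hasFDerivAt
    exact (hf.comp_hasDerivAt (0 : ℝ) hl).const_mul _
  rw [h2.unique h1, hJ]
  simp

theorem exists_linear_flow {E : Type*} [NormedAddCommGroup E] [NormedSpace ℝ E] [CompleteSpace E]
    (A : E →L[ℝ] E) (y : E) : ∃ g : ℝ → E, g 0 = y ∧ ∀ s, HasDerivAt g (A (g s)) s := by
  refine ⟨fun s => exp (s • A) y, by simp [exp_zero], fun s => ?_⟩
  simpa using (hasDerivAt_exp_smul_const' A s).clm_apply (hasDerivAt_const s y)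

end BanachAlgebra

/-! ### Conjugation and the derivative of exp on a commutator-closed subspace. -/

section Subalgebra

open NormedSpace

variable {𝔸 : Type*} [NormedRing 𝔸] [NormedAlgebra ℝ 𝔸] [FiniteDimensional ℝ 𝔸] [CompleteSpace 𝔸]
  {V : Submodule ℝ 𝔸}

/-- A linear space of matrices closed under commutators is stable under conjugation by the
exponentials of its elements. -/
theorem exp_neg_mul_mul_exp_mem (hV : ∀ x ∈ V, ∀ y ∈ V, x * y - y * x ∈ V) {a y : 𝔸} (ha : a ∈ V)
    (hy : y ∈ V) : exp (-a) * y * exp a ∈ V := by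
  -- The linear equation g' = ga - ag is solved inside `V`. Since exp(sa) g(s) exp(-sa) is constant,
  -- g(1) is the conjugate in question.
  let ad : V →L[ℝ] V := LinearMap.toContinuousLinearMap
    { toFun := fun x => ⟨x * a - a * x, hV x x.2 a ha⟩
      map_add' := fun x z => Subtype.ext (by simp [add_mul, mul_add]; abel)
      map_smul' := fun c x => Subtype.ext (by simp [smul_sub]) }
  obtain ⟨g, hg0, hg1⟩ := exists_linear_flow ad ⟨y, hy⟩
  have hg : ∀ s, HasDerivAt (fun s => (g s : 𝔸)) (g s * a - a * g s) s := fun s =>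
    V.subtypeL.hasFDerivAt.comp_hasDerivAt s (hg1 s)
  have hd : ∀ s : ℝ, HasDerivAt (fun s : ℝ => exp (s • a) * g s * exp (s • -a)) 0 s := by
    intro s
    refine (((hasDerivAt_exp_smul_const a s).fun_mul (hg s)).fun_mul
      (hasDerivAt_exp_smul_const' (-a) s)).congr_deriv ?_
    noncomm_ring
  have hconst := is_const_of_deriv_eq_zero (fun s => (hd s).differentiableAt)
    (fun s => (hd s).deriv) 1 0
  have hy' : exp a * g 1 * exp (-a) = y := by
    simpa [hg0, exp_zero] using hconst
  have : exp (-a) * y * exp a = g 1 := by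
    rw [← hy']
    calc exp (-a) * (exp a * g 1 * exp (-a)) * exp a
        = (exp (-a) * exp a) * g 1 * (exp (-a) * exp a) := by simp only [mul_assoc]
      _ = g 1 := by rw [exp_neg_mul_exp, one_mul, mul_one]
  rw [this]
  exact (g 1).2

omit [CompleteSpace 𝔸] in
-- A linear left inverse of the inclusion is automatically continuous in finite dimension. It lets
-- integrals and operators with values in `V` be handled inside `V`.
theorem exists_continuous_retraction (V : Submodule ℝ 𝔸) :
    ∃ P : 𝔸 →L[ℝ] V, ∀ v : V, P v = v := by
  obtain ⟨p, hp⟩ := V.subtype.exists_leftInverse_of_injective V.ker_subtype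
  exact ⟨LinearMap.toContinuousLinearMap p, fun v => LinearMap.congr_fun hp v⟩

omit [FiniteDimensional ℝ 𝔸] in
theorem continuous_conj_exp (a y : 𝔸) :
    Continuous fun s : ℝ => exp (s • -a) * y * exp (s • a) := by
  have hc := continuous_exp 𝔸
  fun_prop

/-- The integrand of the integral formula stays in `V`, and a continuous linear map onto `V` that
fixes `V` commutes with the integral. -/
theorem exp_neg_mul_fderiv_exp_mem (hV : ∀ x ∈ V, ∀ y ∈ V, x * y - y * x ∈ V) {a y : 𝔸}
    (ha : a ∈ V) (hy : y ∈ V) : exp (-a) * fderiv ℝ exp a y ∈ V := by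
  obtain ⟨P, hP⟩ := exists_continuous_retraction V
  rw [exp_neg_mul_fderiv_exp]
  have h := (V.subtypeL ∘L P).intervalIntegral_comp_comm (a := 0) (b := 1) (μ := MeasureTheory.volume)
    ((continuous_conj_exp a y).intervalIntegrable _ _)
  have h2 : ∀ s : ℝ, (V.subtypeL ∘L P) (exp (s • -a) * y * exp (s • a))
      = exp (s • -a) * y * exp (s • a) := by
    intro s
    have hm : exp (s • -a) * y * exp (s • a) ∈ V := by
      rw [smul_neg]
      exact exp_neg_mul_mul_exp_mem hV (V.smul_mem s ha) hy
    exact congrArg Subtype.val (hP ⟨_, hm⟩)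
  simp only [h2] at h
  rw [h]
  exact (P _).2

omit [FiniteDimensional ℝ 𝔸] in
/-- An inner product that is invariant under conjugation only sees the undeformed part of the
derivative of the exponential. -/
theorem form_exp_neg_mul_fderiv_exp (β : 𝔸 →L[ℝ] 𝔸 →L[ℝ] ℝ)
    (hβ : ∀ u v x y : 𝔸, u * v = 1 → v * u = 1 → β (u * x * v) (u * y * v) = β x y) (a y : 𝔸) :
    β a (exp (-a) * fderiv ℝ exp a y) = β a y := by
  rw [exp_neg_mul_fderiv_exp, ← (β a).intervalIntegral_comp_comm
    ((continuous_conj_exp a y).intervalIntegrable _ _)]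
  have h : ∀ s : ℝ, β a (exp (s • -a) * y * exp (s • a)) = β a y := by
    intro s
    have h1 := hβ (exp (s • -a)) (exp (s • a)) a y
      (by rw [smul_neg]; exact exp_neg_mul_exp _) (by rw [smul_neg]; exact exp_mul_exp_neg _)
    let _ : NormedAlgebra ℚ 𝔸 := NormedAlgebra.restrictScalars ℚ ℝ 𝔸
    have h2 : exp (s • -a) * a * exp (s • a) = a := by
      rw [smul_neg]
      exact (((Commute.refl a).smul_right s) : SemiconjBy a (s • a) (s • a)).exp_neg_mul_mul_exp_eq_self
    rwa [h2] at h1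
  simp only [h, intervalIntegral.integral_const, sub_zero, one_smul]

end Subalgebra

end QuantumControl

/-! ### Local inversion of exp along curves and the shortening move. -/

namespace QuantumControl

theorem eventually_isUnit_of_continuous {E : Type*} [NormedAddCommGroup E] [NormedSpace ℝ E]
    [CompleteSpace E] {T : E → E →L[ℝ] E} (hT : Continuous T) {a : E} (ha : IsUnit (T a)) :
    ∀ᶠ b in 𝓝 a, IsUnit (T b) :=
  hT.continuousAt.eventually (Units.isOpen.mem_nhds ha)

/-- Local solvability of the implicit differential equation `T (α t) (α' t) = x` at a point where
`T` is invertible. -/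
theorem exists_implicit_flow {E : Type*} [NormedAddCommGroup E] [NormedSpace ℝ E] [CompleteSpace E]
    {T : E → E →L[ℝ] E} (hT : ContDiff ℝ 1 T) {a : E} (ha : IsUnit (T a)) (x : E) :
    ∃ α α' : ℝ → E, α 0 = a ∧ ∃ δ > 0, ∀ t ∈ Ioo (-δ) δ,
      HasDerivAt α (α' t) t ∧ T (α t) (α' t) = x := by
  have hv : ContDiffAt ℝ 1 (fun b => Ring.inverse (T b) x) a := by
    obtain ⟨u, hu⟩ := ha
    have h1 : ContDiffAt ℝ 1 (fun b => Ring.inverse (T b)) a :=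
      ContDiffAt.comp (g := Ring.inverse) a (hu ▸ contDiffAt_ringInverse ℝ u) hT.contDiffAt
    exact h1.clm_apply contDiffAt_const
  obtain ⟨α, hα0, δ, hδ, hα⟩ :=
    hv.exists_forall_mem_closedBall_exists_eq_forall_mem_Ioo_hasDerivAt₀ 0
  have hcont : ContinuousAt α 0 := (hα 0 ⟨by linarith, by linarith⟩).continuousAt
  have hU : ∀ᶠ t in 𝓝 (0 : ℝ), IsUnit (T (α t)) := by
    refine Tendsto.eventually (p := fun b => IsUnit (T b)) hcont ?_
    rw [hα0]
    exact eventually_isUnit_of_continuous hT.continuous ha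
  obtain ⟨δ', hδ', hU⟩ := Metric.eventually_nhds_iff.1 hU
  refine ⟨α, fun t => Ring.inverse (T (α t)) x, hα0, min δ δ', lt_min hδ hδ', fun t ht => ?_⟩
  have h1 := lt_of_lt_of_le ht.2 (min_le_left _ _)
  have h2 := lt_of_lt_of_le ht.2 (min_le_right _ _)
  have h3 : -δ < t := by linarith [ht.1, min_le_left δ δ']
  have h4 : -δ' < t := by linarith [ht.1, min_le_right δ δ']
  refine ⟨hα t ⟨by linarith, by linarith⟩, ?_⟩
  have hu := hU (y := t) (by rw [Real.dist_eq, sub_zero, abs_lt]; exact ⟨h4, h2⟩)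
  have := congrArg (fun f : E →L[ℝ] E => f x) (Ring.mul_inverse_cancel _ hu)
  simpa using this

section Subalgebra

open NormedSpace

variable {𝔸 : Type*} [NormedRing 𝔸] [NormedAlgebra ℝ 𝔸] [FiniteDimensional ℝ 𝔸] [CompleteSpace 𝔸]
  {V : Submodule ℝ 𝔸}

/-- Near the origin, `exp a * exp (ε x)` is the exponential of a differentiable curve in `V`
through `a`, whose velocity `y` at `a` is `x` up to the derivative of the exponential. -/
theorem exists_exp_curve (hV : ∀ x ∈ V, ∀ y ∈ V, x * y - y * x ∈ V) :
    ∃ r > 0, ∀ a ∈ V, ‖a‖ < r → ∀ x ∈ V, ∃ (α : ℝ → 𝔸) (y : 𝔸), α 0 = a ∧ HasDerivAt α y 0 ∧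
      exp (-a) * fderiv ℝ exp a y = x ∧
      ∀ᶠ ε in 𝓝 0, α ε ∈ V ∧ exp (α ε) = exp a * exp (ε • x) := by
  obtain ⟨P, hP⟩ := exists_continuous_retraction V
  let T : V → V →L[ℝ] V := fun a =>
    P ∘L (ContinuousLinearMap.mul ℝ 𝔸 (exp (-(a : 𝔸))) ∘L fderiv ℝ exp (a : 𝔸)) ∘L V.subtypeL
  have hT : ContDiff ℝ 1 T := by
    have hsub : ContDiff ℝ 1 (fun a : V => (a : 𝔸)) := V.subtypeL.contDiff
    have h1 : ContDiff ℝ 1 (fun a : V => fderiv ℝ (exp : 𝔸 → 𝔸) (a : 𝔸)) :=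
      ((contDiff_exp 𝔸 (n := 2)).fderiv_right (m := 1) (by norm_num)).comp hsub
    have h2 : ContDiff ℝ 1 (fun a : V => ContinuousLinearMap.mul ℝ 𝔸 (exp (-(a : 𝔸)))) :=
      (ContinuousLinearMap.mul ℝ 𝔸).contDiff.comp ((contDiff_exp 𝔸).comp hsub.neg)
    exact contDiff_const.clm_comp ((h2.clm_comp h1).clm_comp contDiff_const)
  have hTV : ∀ a y : V, ((T a y : V) : 𝔸) = exp (-(a : 𝔸)) * fderiv ℝ exp (a : 𝔸) (y : 𝔸) :=
    fun a y => congrArg Subtype.val (hP ⟨_, exp_neg_mul_fderiv_exp_mem hV a.2 y.2⟩)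
  have hT0 : T 0 = 1 := by
    ext y
    rw [hTV, ZeroMemClass.coe_zero, exp_neg_mul_fderiv_exp]
    simp [exp_zero]
  have hunit : ∀ᶠ a in 𝓝 (0 : V), IsUnit (T a) :=
    eventually_isUnit_of_continuous hT.continuous (by rw [hT0]; exact isUnit_one)
  obtain ⟨r, hr, hunit⟩ := Metric.eventually_nhds_iff.1 hunit
  refine ⟨r, hr, fun a ha har x hx => ?_⟩
  have hua : IsUnit (T ⟨a, ha⟩) := hunit (by rw [dist_zero_right]; exact har)
  obtain ⟨α, α', hα0, δ, hδ, hα⟩ := exists_implicit_flow hT hua ⟨x, hx⟩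
  have hαd : ∀ t ∈ Ioo (-δ) δ, HasDerivAt (fun t => (α t : 𝔸)) (α' t) t := fun t ht =>
    V.subtypeL.hasFDerivAt.comp_hasDerivAt t (hα t ht).1
  have h0 : (0 : ℝ) ∈ Ioo (-δ) δ := ⟨by linarith, hδ⟩
  refine ⟨fun t => α t, α' 0, by simp only [hα0], hαd 0 h0, ?_, ?_⟩
  · have := hTV (α 0) (α' 0)
    rw [(hα 0 h0).2, hα0] at this
    exact this.symm
  · filter_upwards [isOpen_Ioo.mem_nhds h0] with t ht
    refine ⟨(α t).2, ?_⟩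
    -- The equation for α says (exp α)' = exp α · x, so exp(α s) exp(-sx) is constant.
    have hd : ∀ s ∈ Ioo (-δ) δ, HasDerivAt (fun s => exp (α s : 𝔸) * exp (s • -x)) 0 s := by
      intro s hs
      have hf : HasFDerivAt exp (fderiv ℝ exp (α s : 𝔸)) (α s : 𝔸) :=
        ((contDiff_exp 𝔸 (n := 1)).differentiable (by norm_num) _).hasFDerivAt
      have h1 : exp (-(α s : 𝔸)) * fderiv ℝ exp (α s : 𝔸) (α' s) = x := by
        rw [← hTV, (hα s hs).2]
      have h2 : fderiv ℝ exp (α s : 𝔸) (α' s) = exp (α s : 𝔸) * x := by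
        rw [← h1, ← mul_assoc, exp_mul_exp_neg, one_mul]
      refine ((hf.comp_hasDerivAt s (hαd s hs)).fun_mul
        (hasDerivAt_exp_smul_const' (-x) s)).congr_deriv ?_
      rw [h2]
      simp [mul_assoc]
    have hconst := isOpen_Ioo.is_const_of_deriv_eq_zero isPreconnected_Ioo
      (fun s hs => (hd s hs).differentiableAt.differentiableWithinAt)
      (fun s hs => (hd s hs).deriv) ht h0
    simp only [zero_smul, neg_zero, exp_zero, mul_one, hα0, smul_neg] at hconst
    rw [← hconst, mul_assoc, exp_neg_mul_exp, mul_one]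

/-- Two distinct consecutive short factors of a product of exponentials can be replaced by shorter
ones. -/
theorem exists_shorter_pair (hV : ∀ x ∈ V, ∀ y ∈ V, x * y - y * x ∈ V) (β : 𝔸 →L[ℝ] 𝔸 →L[ℝ] ℝ)
    (hsymm : ∀ x y, β x y = β y x)
    (hβ : ∀ u v x y : 𝔸, u * v = 1 → v * u = 1 → β (u * x * v) (u * y * v) = β x y)
    (hpos : ∀ x ∈ V, x ≠ 0 → 0 < β x x) :
    ∃ r > 0, ∀ a ∈ V, ∀ b ∈ V, ‖a‖ < r → ‖b‖ < r → a ≠ b → ∃ a' ∈ V, ∃ b' ∈ V,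
      exp a' * exp b' = exp a * exp b ∧ β a' a' + β b' b' < β a a + β b b := by
  obtain ⟨r, hr, hcurve⟩ := exists_exp_curve hV
  refine ⟨r, hr, fun a ha b hb har hbr hab => ?_⟩
  set x := b - a with hx
  have hxV : x ∈ V := V.sub_mem hb ha
  -- Chosen so that exp b · exp(εz) = exp(-εx) · exp b, which cancels the factor exp(εx) placed
  -- after exp a.
  set z := exp (-b) * (-x) * exp b with hz
  have hzV : z ∈ V := exp_neg_mul_mul_exp_mem hV hb (V.neg_mem hxV)
  obtain ⟨α, y, hα0, hαd, hαy, hα⟩ := hcurve a ha har x hxV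
  obtain ⟨γ, w, hγ0, hγd, hγw, hγ⟩ := hcurve b hb hbr z hzV
  have hay : β a y = β a x := by
    rw [← form_exp_neg_mul_fderiv_exp β hβ, hαy]
  have hbw : β b w = -β b x := by
    rw [← form_exp_neg_mul_fderiv_exp β hβ, hγw, hz]
    have h1 := hβ (exp (-b)) (exp b) b (-x) (exp_neg_mul_exp b) (exp_mul_exp_neg b)
    have h2 : exp (-b) * b * exp b = b := by
      let _ : NormedAlgebra ℚ 𝔸 := NormedAlgebra.restrictScalars ℚ ℝ 𝔸
      exact (Commute.refl b : SemiconjBy b b b).exp_neg_mul_mul_exp_eq_self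
    rw [h2] at h1
    rw [h1, map_neg]
  -- By invariance only β(a,x) and -β(b,x) survive, and 2β(a,x) - 2β(b,x) = -2β(x,x) because x = b -
  -- a.
  have hφ : HasDerivAt (fun ε => β (α ε) (α ε) + β (γ ε) (γ ε)) (-2 * β x x) 0 := by
    have e1 := (β.hasFDerivAt.comp_hasDerivAt (0 : ℝ) hαd).clm_apply hαd
    have e2 := (β.hasFDerivAt.comp_hasDerivAt (0 : ℝ) hγd).clm_apply hγd
    refine (e1.add e2).congr_deriv ?_
    simp only [Function.comp_apply, hα0, hγ0]
    rw [hsymm y a, hsymm w b, hay, hbw, hx]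
    simp only [map_sub, sub_apply]
    rw [hsymm b a]
    ring
  have hneg : -2 * β x x < 0 := by
    have := hpos x hxV (sub_ne_zero.2 hab.symm)
    linarith
  have hdec : ∀ᶠ ε in 𝓝[>] (0 : ℝ), β (α ε) (α ε) + β (γ ε) (γ ε) < β a a + β b b := by
    have h1 := (hasDerivAt_iff_tendsto_slope.1 hφ).eventually (gt_mem_nhds hneg)
    have h2 : ∀ᶠ ε in 𝓝[>] (0 : ℝ), slope (fun ε => β (α ε) (α ε) + β (γ ε) (γ ε)) 0 ε < 0 :=
      h1.filter_mono (nhdsWithin_mono _ fun t ht => ne_of_gt ht)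
    filter_upwards [h2, self_mem_nhdsWithin] with ε h3 h4
    have h4 : 0 < ε := h4
    rw [slope_def_field, sub_zero, hα0, hγ0, div_neg_iff] at h3
    rcases h3 with h3 | h3 <;> linarith
  obtain ⟨ε, h1, ⟨h2, h3⟩, h4, h5⟩ := (hdec.and ((hα.filter_mono nhdsWithin_le_nhds).and
    (hγ.filter_mono nhdsWithin_le_nhds))).exists
  refine ⟨α ε, h2, γ ε, h4, ?_, h1⟩
  have h6 : exp (ε • z) = exp (-b) * exp (-(ε • x)) * exp b := by
    rw [← exp_conj_exp, hz]
    congr 1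
    simp
  rw [h3, h5, h6]
  calc exp a * exp (ε • x) * (exp b * (exp (-b) * exp (-(ε • x)) * exp b))
      = exp a * (exp (ε • x) * ((exp b * exp (-b)) * exp (-(ε • x)))) * exp b := by
        simp only [mul_assoc]
    _ = exp a * exp b := by
        rw [exp_mul_exp_neg, one_mul, exp_mul_exp_neg, mul_one]

end Subalgebra

end QuantumControl

/-! ### Energy minimisation and the triangle inequality for exponents. -/

namespace QuantumControl

/-- A continuous function with quadratic growth attains its minimum on a nonempty closed set. -/
theorem exists_forall_le_of_quadratic_growth {E : Type*} [NormedAddCommGroup E] [ProperSpace E]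
    {S : Set E} (hS : IsClosed S) (hne : S.Nonempty) {φ : E → ℝ} (hφ : Continuous φ) {c : ℝ}
    (hc : 0 < c) (hle : ∀ x ∈ S, c * ‖x‖ ^ 2 ≤ φ x) : ∃ x ∈ S, ∀ y ∈ S, φ x ≤ φ y := by
  obtain ⟨x₀, hx₀⟩ := hne
  obtain ⟨x, hx, hmin⟩ := hφ.continuousOn.exists_isMinOn' hS hx₀ (by
    have h1 : Tendsto (fun x : E => c * ‖x‖ ^ 2) (cocompact E) atTop :=
      ((tendsto_pow_atTop two_ne_zero).comp (tendsto_norm_cocompact_atTop (E := E))).const_mul_atTop hc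
    rw [eventually_inf_principal]
    filter_upwards [h1.eventually_ge_atTop (φ x₀)] with x h2 h3 using h2.trans (hle x h3))
  exact ⟨x, hx, fun y hy => hmin hy⟩

section Subalgebra

open NormedSpace

variable {𝔸 : Type*} [NormedRing 𝔸] [NormedAlgebra ℝ 𝔸] [FiniteDimensional ℝ 𝔸]
  {V : Submodule ℝ 𝔸}

/-- The form has a positive lower bound on the compact unit sphere of `V`; homogeneity does the
rest. -/
theorem exists_quadratic_lower_bound (β : 𝔸 →L[ℝ] 𝔸 →L[ℝ] ℝ)
    (hpos : ∀ x ∈ V, x ≠ 0 → 0 < β x x) : ∃ c > 0, ∀ x ∈ V, c * ‖x‖ ^ 2 ≤ β x x := by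
  have : ProperSpace 𝔸 := FiniteDimensional.proper ℝ 𝔸
  have hcomp : IsCompact (Metric.sphere (0 : 𝔸) 1 ∩ V) :=
    (isCompact_sphere _ _).inter_right V.closed_of_finiteDimensional
  have hcont : Continuous fun x => β x x := β.continuous.clm_apply continuous_id
  obtain ⟨c, hc, hle⟩ := hcomp.exists_forall_le' (a := 0) hcont.continuousOn (by
    rintro x ⟨hx1, hx2⟩
    exact hpos x hx2 (ne_zero_of_mem_unit_sphere ⟨x, hx1⟩))
  refine ⟨c, hc, fun x hx => ?_⟩
  rcases eq_or_ne x 0 with rfl | h0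
  · simp
  · have hn : ‖x‖ ≠ 0 := norm_ne_zero_iff.2 h0
    have h1 := hle (‖x‖⁻¹ • x) ⟨by simp [norm_smul, hn], V.smul_mem _ hx⟩
    simp only [map_smul, smul_apply, smul_eq_mul] at h1
    calc c * ‖x‖ ^ 2 ≤ (‖x‖⁻¹ * (‖x‖⁻¹ * β x x)) * ‖x‖ ^ 2 := by gcongr
      _ = β x x := by field_simp

variable [CompleteSpace 𝔸]

theorem exp_fiber_isClosed (g : 𝔸) : IsClosed {x : 𝔸 | x ∈ V ∧ exp x = g} :=
  V.closed_of_finiteDimensional.inter (isClosed_eq (continuous_exp 𝔸) continuous_const)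

omit [FiniteDimensional ℝ 𝔸] in
theorem prod_map_exp_replicate (n : ℕ) (a : 𝔸) :
    ((List.replicate n a).map exp).prod = exp ((n : ℝ) • a) := by
  rw [List.map_replicate, List.prod_replicate, exp_natCast_smul]

/-- A product of many short exponentials is a single exponential, with the expected bound for
the quadratic form: in an energy minimising product of given length all factors agree. -/
theorem exists_exp_eq_list_prod (hV : ∀ x ∈ V, ∀ y ∈ V, x * y - y * x ∈ V)
    (β : 𝔸 →L[ℝ] 𝔸 →L[ℝ] ℝ) (hsymm : ∀ x y, β x y = β y x)
    (hβ : ∀ u v x y : 𝔸, u * v = 1 → v * u = 1 → β (u * x * v) (u * y * v) = β x y)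
    (hpos : ∀ x ∈ V, x ≠ 0 → 0 < β x x) :
    ∃ ρ > 0, ∀ l : List 𝔸, l ≠ [] → (∀ x ∈ l, x ∈ V) → (l.map fun x => β x x).sum < ρ →
      ∃ z ∈ V, exp z = (l.map exp).prod ∧ β z z ≤ l.length * (l.map fun x => β x x).sum := by
  have : ProperSpace 𝔸 := FiniteDimensional.proper ℝ 𝔸
  obtain ⟨r, hr, hshort⟩ := exists_shorter_pair hV β hsymm hβ hpos
  obtain ⟨c, hc, hlow⟩ := exists_quadratic_lower_bound β hpos
  have hnn : ∀ x ∈ V, 0 ≤ β x x := fun x hx => (by positivity : 0 ≤ c * ‖x‖ ^ 2).trans (hlow x hx)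
  -- With energy below c r², every factor of a minimiser has norm below r, so the shortening move
  -- applies to it.
  refine ⟨c * r ^ 2, by positivity, fun l hl hlV hlρ => ?_⟩
  obtain ⟨n, hn⟩ : ∃ n, l.length = n := ⟨_, rfl⟩
  have hrep : ∀ l' : List 𝔸, l'.length = n → ∃ f : Fin n → 𝔸, (List.finRange n).map f = l' := by
    rintro l' rfl
    exact ⟨l'.get, by simp⟩
  have hsum : ∀ f : Fin n → 𝔸, ∑ i, β (f i) (f i)
      = (((List.finRange n).map f).map fun x => β x x).sum := by
    intro f
    rw [Fin.sum_univ_def, List.map_map]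
    rfl
  let S : Set (Fin n → 𝔸) :=
    {f | (∀ i, f i ∈ V) ∧ (((List.finRange n).map f).map exp).prod = (l.map exp).prod}
  have hmemS : ∀ f : Fin n → 𝔸, (∀ x ∈ (List.finRange n).map f, x ∈ V) →
      (((List.finRange n).map f).map exp).prod = (l.map exp).prod → f ∈ S := fun f h1 h2 =>
    ⟨fun i => h1 _ (List.mem_map_of_mem (List.mem_finRange i)), h2⟩
  obtain ⟨f₀, hf₀⟩ := hrep l hn
  have hf₀S : f₀ ∈ S := hmemS f₀ (by rwa [hf₀]) (by rw [hf₀])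
  have hSc : IsClosed S := by
    refine IsClosed.inter (s₁ := {f : Fin n → 𝔸 | ∀ i, f i ∈ V}) ?_ ?_
    · simp only [ofPred_forall]
      exact isClosed_iInter fun i => V.closed_of_finiteDimensional.preimage (continuous_apply i)
    · refine isClosed_eq ?_ continuous_const
      simp only [List.map_map]
      exact continuous_list_prod _ fun i _ => (continuous_exp 𝔸).comp (continuous_apply i)
  obtain ⟨f, hfS, hfmin⟩ := exists_forall_le_of_quadratic_growth hSc ⟨f₀, hf₀S⟩
    (φ := fun f => ∑ i, β (f i) (f i))
    (continuous_finsetSum _ fun i _ =>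
      (β.continuous.comp (continuous_apply i)).clm_apply (continuous_apply i)) hc (by
      intro f hf
      have hn0 : n ≠ 0 := by rintro rfl; exact hl (List.length_eq_zero_iff.1 hn)
      have : Nonempty (Fin n) := ⟨⟨0, Nat.pos_of_ne_zero hn0⟩⟩
      -- The sup norm of a tuple is attained at one entry, whose energy alone gives the quadratic
      -- growth.
      obtain ⟨i, hi⟩ := Finite.exists_max fun i => ‖f i‖
      have h1 : ‖f‖ ≤ ‖f i‖ := (pi_norm_le_iff_of_nonneg (norm_nonneg _)).2 hi
      calc c * ‖f‖ ^ 2 ≤ c * ‖f i‖ ^ 2 := by gcongr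
        _ ≤ β (f i) (f i) := hlow _ (hf.1 i)
        _ ≤ ∑ i, β (f i) (f i) := Finset.single_le_sum (f := fun i => β (f i) (f i))
          (fun j _ => hnn _ (hf.1 j)) (Finset.mem_univ i))
  obtain ⟨m, hm⟩ : ∃ m, m = (List.finRange n).map f := ⟨_, rfl⟩
  have hmlen : m.length = n := by simp [hm]
  have hmV : ∀ x ∈ m, x ∈ V := by
    intro x hx
    rw [hm] at hx
    obtain ⟨i, -, rfl⟩ := List.mem_map.1 hx
    exact hfS.1 i
  have hmprod : (m.map exp).prod = (l.map exp).prod := hm ▸ hfS.2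
  have hmmin : ∀ l' : List 𝔸, l'.length = n → (∀ x ∈ l', x ∈ V) →
      (l'.map exp).prod = (l.map exp).prod →
      (m.map fun x => β x x).sum ≤ (l'.map fun x => β x x).sum := by
    intro l' h1 h2 h3
    obtain ⟨f', hf'⟩ := hrep l' h1
    have h4 := hfmin f' (hmemS f' (by rwa [hf']) (by rw [hf', h3]))
    simp only [hsum] at h4
    rwa [hf', ← hm] at h4
  have hml := hmmin l hn hlV rfl
  have hsmall : ∀ x ∈ m, ‖x‖ < r := by
    intro x hx
    have h1 : β x x ≤ (m.map fun x => β x x).sum := by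
      refine List.single_le_sum ?_ _ (List.mem_map_of_mem hx)
      intro y hy
      obtain ⟨z, hz, rfl⟩ := List.mem_map.1 hy
      exact hnn z (hmV z hz)
    have h2 : c * ‖x‖ ^ 2 < c * r ^ 2 := by linarith [hlow x (hmV x hx)]
    exact lt_of_pow_lt_pow_left₀ 2 hr.le (lt_of_mul_lt_mul_left h2 hc.le)
  have hchain : List.IsChain (fun x y => x = y) m := by
    rw [List.isChain_iff_forall_rel_of_append_cons_cons]
    intro a b l₁ l₂ hsplit
    by_contra hab
    have ham : a ∈ m := by simp [hsplit]
    have hbm : b ∈ m := by simp [hsplit]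
    obtain ⟨a', ha', b', hb', hprod, hlt⟩ :=
      hshort a (hmV a ham) b (hmV b hbm) (hsmall a ham) (hsmall b hbm) hab
    have h1 := hmmin (l₁ ++ a' :: b' :: l₂) (by rw [← hmlen, hsplit]; simp)
      (by
        intro x hx
        have h2 : ∀ y ∈ l₁ ++ a :: b :: l₂, y ∈ V := hsplit ▸ hmV
        simp only [List.mem_append, List.mem_cons] at hx h2
        rcases hx with hx | rfl | rfl | hx
        · exact h2 x (Or.inl hx)
        · exact ha'
        · exact hb'
        · exact h2 x (Or.inr (Or.inr (Or.inr hx))))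
      (by
        rw [← hmprod, hsplit]
        simp only [List.map_append, List.map_cons, List.prod_append, List.prod_cons]
        rw [← mul_assoc (exp a'), hprod, mul_assoc])
    rw [hsplit] at h1
    simp only [List.map_append, List.map_cons, List.sum_append, List.sum_cons] at h1
    linarith
  have hm0 : m ≠ [] := by
    rintro rfl
    exact hl (List.length_eq_zero_iff.1 (hn.trans hmlen.symm))
  obtain ⟨a, t, rfl⟩ := List.exists_cons_of_ne_nil hm0
  have hreplicate := List.isChain_eq_iff_eq_replicate.1 hchain a (by simp)
  rw [hmlen] at hreplicate
  have haV : a ∈ V := hmV a (by simp)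
  -- β(na,na) = n · (n β(a,a)), that is n times the minimal energy, which is at most n times the
  -- energy of `l`.
  refine ⟨(n : ℝ) • a, V.smul_mem _ haV, ?_, ?_⟩
  · rw [← hmprod, hreplicate, prod_map_exp_replicate]
  · rw [hreplicate, List.map_replicate, List.sum_replicate, nsmul_eq_mul] at hml
    rw [hn]
    simp only [map_smul, smul_apply, smul_eq_mul]
    gcongr

/-- The product of two exponentials of elements of `V` is the exponential of an element of `V` whose
length is at most the sum of the two lengths. -/
theorem exists_exp_eq_exp_mul_exp (hV : ∀ x ∈ V, ∀ y ∈ V, x * y - y * x ∈ V)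
    (β : 𝔸 →L[ℝ] 𝔸 →L[ℝ] ℝ) (hsymm : ∀ x y, β x y = β y x)
    (hβ : ∀ u v x y : 𝔸, u * v = 1 → v * u = 1 → β (u * x * v) (u * y * v) = β x y)
    (hpos : ∀ x ∈ V, x ≠ 0 → 0 < β x x) {x y : 𝔸} (hx : x ∈ V) (hy : y ∈ V) :
    ∃ z ∈ V, exp z = exp x * exp y ∧ √(β z z) ≤ √(β x x) + √(β y y) := by
  have : ProperSpace 𝔸 := FiniteDimensional.proper ℝ 𝔸
  obtain ⟨ρ, hρ, hlist⟩ := exists_exp_eq_list_prod hV β hsymm hβ hpos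
  obtain ⟨c, hc, hlow⟩ := exists_quadratic_lower_bound β hpos
  have hnn : ∀ x ∈ V, 0 ≤ β x x := fun x hx => (by positivity : 0 ≤ c * ‖x‖ ^ 2).trans (hlow x hx)
  set a := √(β x x) with ha
  set b := √(β y y) with hb
  have ha0 : 0 ≤ a := Real.sqrt_nonneg _
  have hb0 : 0 ≤ b := Real.sqrt_nonneg _
  have haa : β x x = a ^ 2 := (Real.sq_sqrt (hnn x hx)).symm
  have hbb : β y y = b ^ 2 := (Real.sq_sqrt (hnn y hy)).symm
  -- Cut x into p ≈ na and y into q ≈ nb equal pieces, each of length at most about 1/n. Rounding up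
  -- costs at most 1 in each count, hence the 2; taking floor plus one keeps p and q positive when a
  -- or b vanishes.
  have hsub : ∀ n : ℕ, 0 < n → (a + b) / n < ρ →
      ∃ z ∈ V, exp z = exp x * exp y ∧ β z z ≤ (n * (a + b) + 2) * ((a + b) / n) := by
    intro n hn hnρ
    have hn' : (0 : ℝ) < n := Nat.cast_pos.2 hn
    have hfloor : ∀ s : ℝ, 0 ≤ s → ∃ p : ℕ, 0 < p ∧ n * s ≤ p ∧ p ≤ n * s + 1 := fun s hs =>
      ⟨⌊n * s⌋₊ + 1, Nat.succ_pos _, by push_cast; exact (Nat.lt_floor_add_one _).le,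
        by push_cast; gcongr; exact Nat.floor_le (by positivity)⟩
    obtain ⟨p, hp, hp1, hp2⟩ := hfloor a ha0
    obtain ⟨q, hq, hq1, hq2⟩ := hfloor b hb0
    have hfrac : ∀ (s : ℝ) (p : ℕ), 0 ≤ s → 0 < p → n * s ≤ p → s ^ 2 / p ≤ s / n := by
      intro s p hs hp hsp
      have hp' : (0 : ℝ) < p := Nat.cast_pos.2 hp
      rw [div_le_div_iff₀ hp' hn']
      nlinarith
    have hen : ∀ (x : 𝔸) (s : ℝ) (p : ℕ), 0 < p → β x x = s ^ 2 →
        ((List.replicate p ((p : ℝ)⁻¹ • x)).map fun x => β x x).sum = s ^ 2 / p := by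
      intro x s p hp hs
      have hp' : (p : ℝ) ≠ 0 := Nat.cast_ne_zero.2 hp.ne'
      rw [List.map_replicate, List.sum_replicate, nsmul_eq_mul]
      simp only [map_smul, smul_apply, smul_eq_mul, hs]
      field_simp
    have hpr : ∀ (x : 𝔸) (p : ℕ), 0 < p →
        ((List.replicate p ((p : ℝ)⁻¹ • x)).map exp).prod = exp x := by
      intro x p hp
      have hp' : (p : ℝ) ≠ 0 := Nat.cast_ne_zero.2 hp.ne'
      rw [prod_map_exp_replicate, smul_smul, mul_inv_cancel₀ hp', one_smul]
    have hE : a ^ 2 / p + b ^ 2 / q ≤ (a + b) / n := by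
      rw [add_div]
      exact add_le_add (hfrac a p ha0 hp hp1) (hfrac b q hb0 hq hq1)
    obtain ⟨z, hzV, hz, hzle⟩ := hlist
      (List.replicate p ((p : ℝ)⁻¹ • x) ++ List.replicate q ((q : ℝ)⁻¹ • y))
      (by simp [hp.ne'])
      (by
        intro w hw
        rcases List.mem_append.1 hw with hw | hw
        · rw [List.eq_of_mem_replicate hw]; exact V.smul_mem _ hx
        · rw [List.eq_of_mem_replicate hw]; exact V.smul_mem _ hy)
      (by
        rw [List.map_append, List.sum_append, hen x a p hp haa, hen y b q hq hbb]
        exact hE.trans_lt hnρ)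
    refine ⟨z, hzV, ?_, hzle.trans ?_⟩
    · rw [hz, List.map_append, List.prod_append, hpr x p hp, hpr y q hq]
    · rw [List.map_append, List.sum_append, hen x a p hp haa, hen y b q hq hbb]
      simp only [List.length_append, List.length_replicate, Nat.cast_add]
      exact mul_le_mul (by linarith) hE (by positivity) (by positivity)
  have htend : Tendsto (fun n : ℕ => (a + b) / (n : ℝ)) atTop (𝓝 0) :=
    tendsto_const_div_atTop_nhds_zero_nat _
  have hev := (htend.eventually (gt_mem_nhds hρ)).and (eventually_gt_atTop 0)
  -- The z from `hsub` depends on n. A shortest exponent in the closed fibre obeys all these bounds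
  -- at once.
  obtain ⟨z, ⟨hzV, hz⟩, hzmin⟩ := exists_forall_le_of_quadratic_growth
    (exp_fiber_isClosed (V := V) (exp x * exp y)) (φ := fun z => β z z)
    (by
      obtain ⟨n, h1, h2⟩ := hev.exists
      obtain ⟨z, h3, h4, -⟩ := hsub n h2 h1
      exact ⟨z, h3, h4⟩)
    (β.continuous.clm_apply continuous_id) hc fun z hz => hlow z hz.1
  refine ⟨z, hzV, hz, Real.sqrt_le_iff.2 ⟨by positivity, ?_⟩⟩
  have hlim : Tendsto (fun n : ℕ => (a + b) ^ 2 + 2 * ((a + b) / (n : ℝ))) atTop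
      (𝓝 ((a + b) ^ 2)) := by
    simpa using (htend.const_mul 2).const_add ((a + b) ^ 2)
  refine ge_of_tendsto hlim ?_
  filter_upwards [hev] with n hn
  obtain ⟨w, h3, h4, h5⟩ := hsub n hn.2 hn.1
  refine (hzmin w ⟨h3, h4⟩).trans (h5.trans (le_of_eq ?_))
  have : (n : ℝ) ≠ 0 := Nat.cast_ne_zero.2 hn.2.ne'
  field_simp

end Subalgebra

end QuantumControl

/-! ### Piecewise continuous functions. -/

namespace QuantumControl

section PiecewiseContinuity

variable {E F : Type*} [TopologicalSpace E] [TopologicalSpace F] {a b : ℝ}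

theorem PiecewiseContinuousOn.comp {f : ℝ → E} (hf : PiecewiseContinuousOn f a b) {g : E → F}
    (hg : Continuous g) : PiecewiseContinuousOn (fun t => g (f t)) a b := by
  obtain ⟨⟨S, hS, hc⟩, hr, hl⟩ := hf
  refine ⟨⟨S, hS, fun t ht => hg.continuousAt.comp_continuousWithinAt (hc t ht)⟩,
    fun t ht => ?_, fun t ht => ?_⟩
  · obtain ⟨l, h⟩ := hr t ht
    exact ⟨g l, (hg.tendsto l).comp h⟩
  · obtain ⟨l, h⟩ := hl t ht
    exact ⟨g l, (hg.tendsto l).comp h⟩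

open MeasureTheory in
-- The finite exceptional set is null, which gives measurability; one-sided limits give
-- integrability near each point, and compactness globalises it.
theorem PiecewiseContinuousOn.integrableOn {f : ℝ → ℝ} (hf : PiecewiseContinuousOn f a b) :
    IntegrableOn f (Icc a b) := by
  obtain ⟨⟨S, hS, hc⟩, hr, hl⟩ := hf
  have hm : AEStronglyMeasurable f (volume.restrict (Icc a b)) := by
    have h1 : AEStronglyMeasurable f (volume.restrict (Icc a b \ S)) :=
      ContinuousOn.aestronglyMeasurable (fun t ht => (hc t ht).mono sdiff_subset)
        (measurableSet_Icc.diff hS.measurableSet)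
    rwa [Measure.restrict_congr_set (sdiff_null_ae_eq_self (hS.measure_zero volume))] at h1
  have hloc : LocallyIntegrableOn f (Icc a b) := by
    intro t ht
    have hside : ∀ s ⊆ Icc a b, MeasurableSet s → ∀ l, Tendsto f (𝓝[s] t) (𝓝 l) → IntegrableAtFilter f (𝓝[s] t) := by
      intro s hs hsm l h
      have := hsm.nhdsWithin_isMeasurablyGenerated t
      exact Measure.FiniteAtFilter.integrableAtFilter_of_tendsto
        ⟨s, self_mem_nhdsWithin, hm.mono_measure (Measure.restrict_mono hs le_rfl)⟩
        ((volume.finiteAt_nhds t).inf_of_left) h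
    have hempty : ∀ s : Set ℝ, s = ∅ → IntegrableAtFilter f (𝓝[s] t) := by
      rintro s rfl
      exact ⟨∅, by simp, integrableOn_empty⟩
    have hright : IntegrableAtFilter f (𝓝[Ioc t b] t) := by
      rcases ht.2.lt_or_eq with h | h
      · obtain ⟨l, hlim⟩ := hr t ⟨ht.1, h⟩
        exact hside _ (Ioc_subset_Icc_self.trans (Icc_subset_Icc_left ht.1)) measurableSet_Ioc l
          (hlim.mono_left (nhdsWithin_mono _ Ioc_subset_Ioi_self))
      · exact hempty _ (by simp [h])
    have hleft : IntegrableAtFilter f (𝓝[Ico a t] t) := by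
      rcases ht.1.lt_or_eq with h | h
      · obtain ⟨l, hlim⟩ := hl t ⟨h, ht.2⟩
        exact hside _ (Ico_subset_Icc_self.trans (Icc_subset_Icc_right ht.2)) measurableSet_Ico l
          (hlim.mono_left (nhdsWithin_mono _ Ico_subset_Iio_self))
      · exact hempty _ (by simp [h])
    have hpt : IntegrableAtFilter f (𝓝[{t}] t) :=
      ⟨{t}, self_mem_nhdsWithin, integrableOn_singleton (hx := by simp)⟩
    have hunion : Icc a b = Ico a t ∪ ({t} ∪ Ioc t b) := by
      ext s
      simp only [mem_Icc, mem_union, mem_Ico, mem_singleton_iff, mem_Ioc]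
      have h1 := ht.1
      have h2 := ht.2
      constructor
      · rintro ⟨h3, h4⟩
        rcases lt_trichotomy s t with h | h | h <;> simp [*]
      · rintro (⟨h3, h4⟩ | rfl | ⟨h3, h4⟩) <;> constructor <;> linarith
    rw [hunion, nhdsWithin_union, nhdsWithin_union]
    exact IntegrableAtFilter.sup_iff.2 ⟨hleft, IntegrableAtFilter.sup_iff.2 ⟨hpt, hright⟩⟩
  exact hloc.integrableOn_isCompact isCompact_Icc

end PiecewiseContinuity

/-! ### From products of exponentials to solutions of U' = G U. -/

section Evolution

open NormedSpace

variable {𝔸 : Type*} [NormedRing 𝔸] [NormedAlgebra ℝ 𝔸]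

/-- A solution of `U' = G U` is differentiable from the right, also at the jumps of `G`. -/
theorem hasDerivWithinAt_Ici_of_tendsto_generator {G U : ℝ → 𝔸} {T : ℝ}
    (hU : ContinuousOn U (Icc 0 T)) {S : Set ℝ} (hS : S.Finite)
    (hd : ∀ t ∈ Icc 0 T \ S, HasDerivWithinAt U (G t * U t) (Icc 0 T) t) {t : ℝ}
    (ht : t ∈ Ico 0 T) {l : 𝔸} (hl : Tendsto G (𝓝[>] t) (𝓝 l)) :
    HasDerivWithinAt U (l * U t) (Ici t) t := by
  have hs : Ioo t T \ S ∈ 𝓝[>] t := by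
    have h1 : (S \ {t})ᶜ ∈ 𝓝[>] t :=
      mem_nhdsWithin_of_mem_nhds ((hS.subset sdiff_subset).isClosed.isOpen_compl.mem_nhds (by simp))
    filter_upwards [h1, Ioo_mem_nhdsGT ht.2] with s h2 h3
    exact ⟨h3, fun h4 => h2 ⟨h4, h3.1.ne'⟩⟩
  have hda : ∀ s ∈ Ioo t T \ S, HasDerivAt U (G s * U s) s := by
    intro s hs
    have h0 : 0 < s := ht.1.trans_lt hs.1.1
    exact (hd s ⟨⟨h0.le, hs.1.2.le⟩, hs.2⟩).hasDerivAt (Icc_mem_nhds h0 hs.1.2)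
  have hcont : ContinuousWithinAt U (Icc 0 T) t := hU t ⟨ht.1, ht.2.le⟩
  refine hasDerivWithinAt_Ici_of_tendsto_deriv (s := Ioo t T \ S)
    (fun s hs => (hda s hs).differentiableAt.differentiableWithinAt) (hcont.mono ?_) hs ?_
  · exact fun s hs => ⟨ht.1.trans hs.1.1.le, hs.1.2.le⟩
  · have hUt : Tendsto U (𝓝[>] t) (𝓝 (U t)) :=
      hcont.mono_left (nhdsWithin_le_of_mem (by
        filter_upwards [Ioo_mem_nhdsGT ht.2] with s hs using ⟨ht.1.trans hs.1.le, hs.2.le⟩))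
    refine (hl.mul hUt).congr' ?_
    filter_upwards [hs] with s hs using (hda s hs).deriv.symm

variable [FiniteDimensional ℝ 𝔸] [CompleteSpace 𝔸] {V : Submodule ℝ 𝔸}

/-- Suppose that products of exponentials of elements of `V` are such exponentials, with a
subadditive length `q` on the exponents. Then the value at time `T` of the solution of `U' = G U`,
with `G` in `V`, lies up to an error `ε` within distance `∫ q (G t)` of the identity. -/
theorem exists_exp_near_evolution {q : 𝔸 → ℝ} (hq : Continuous q) (hq0 : ∀ x, 0 ≤ q x)
    (hqs : ∀ (c : ℝ) (x : 𝔸), 0 ≤ c → q (c • x) = c * q x)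
    (hmul : ∀ x ∈ V, ∀ y ∈ V, ∃ z ∈ V, exp z = exp x * exp y ∧ q z ≤ q x + q y)
    {K : ℝ} (hK : 0 ≤ K)
    (hbd : ∀ z ∈ V, ∃ w ∈ V, exp w = exp z ∧ q w ≤ q z ∧ ‖w‖ ≤ K * (1 + q z))
    (hiso : ∀ a ∈ V, ∀ x, ‖exp a * x‖ ≤ ‖x‖)
    {G U : ℝ → 𝔸} {T : ℝ} (hT : 0 ≤ T) (hG : PiecewiseContinuousOn G 0 T) (hGV : ∀ t, G t ∈ V)
    (hU : ContinuousOn U (Icc 0 T)) {S : Set ℝ} (hS : S.Finite)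
    (hd : ∀ t ∈ Icc 0 T \ S, HasDerivWithinAt U (G t * U t) (Icc 0 T) t) (hU0 : U 0 = 1)
    {ε : ℝ} (hε : 0 < ε) :
    ∃ z ∈ V, ‖z‖ ≤ K * (1 + ((∫ t in (0 : ℝ)..T, q (G t)) + ε * T)) ∧
      q z ≤ (∫ t in (0 : ℝ)..T, q (G t)) + ε * T ∧ ‖exp z - U T‖ ≤ ε * T := by
  have : ProperSpace 𝔸 := FiniteDimensional.proper ℝ 𝔸
  have hint : MeasureTheory.IntegrableOn (fun t => q (G t)) (Icc 0 T) := (hG.comp hq).integrableOn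
  have hii : ∀ s ∈ Icc 0 T, ∀ t ∈ Icc 0 T,
      IntervalIntegrable (fun t => q (G t)) MeasureTheory.volume s t := fun s hs t ht =>
    (hint.mono_set (ordConnected_Icc.uIcc_subset hs ht)).intervalIntegrable
  set F : ℝ → ℝ := fun t => ∫ s in (0 : ℝ)..t, q (G s) with hF
  have hFc : ContinuousOn F (Icc 0 T) := by
    have := intervalIntegral.continuousOn_primitive_interval (a := 0) (b := T)
      (by rwa [uIcc_of_le hT])
    rwa [uIcc_of_le hT] at this
  have h0T : (0 : ℝ) ∈ Icc 0 T := left_mem_Icc.2 hT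
  have hFT : ∀ t ∈ Icc 0 T, F t ≤ F T := by
    intro t ht
    have h1 := intervalIntegral.integral_add_adjacent_intervals (hii 0 h0T t ht)
      (hii t ht T (right_mem_Icc.2 hT))
    have h2 : 0 ≤ ∫ s in t..T, q (G s) :=
      intervalIntegral.integral_nonneg ht.2 fun s _ => hq0 _
    simp only [hF]
    linarith
  set R := K * (1 + (F T + ε * T)) with hR
  let A : Set ℝ := {t | ∃ z ∈ V, ‖z‖ ≤ R ∧ q z ≤ F t + ε * t ∧ ‖exp z - U t‖ ≤ ε * t}
  suffices hA : Icc 0 T ⊆ A from hA (right_mem_Icc.2 hT)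
  -- The norm bound in `A` costs nothing: `hbd` supplies another exponent with the same exponential,
  -- and F t + εt is largest at T.
  have hred : ∀ t ∈ Icc 0 T, ∀ z ∈ V, q z ≤ F t + ε * t → ‖exp z - U t‖ ≤ ε * t → t ∈ A := by
    intro t ht z hz h1 h2
    obtain ⟨w, hw, h3, h4, h5⟩ := hbd z hz
    refine ⟨w, hw, h5.trans ?_, h4.trans h1, by rwa [h3]⟩
    have h6 := hFT t ht
    have h7 := ht.2
    rw [hR]
    gcongr
    exact h1.trans (by gcongr)
  refine IsClosed.Icc_subset_of_forall_exists_gt ?_ ?_ ?_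
  -- The part of `A` in [0,T] is the projection of a compact set of pairs (t, z); this is why `A`
  -- bounds the norm of z.
  · have hB : IsCompact (Icc (0 : ℝ) T ×ˢ (Metric.closedBall (0 : 𝔸) R ∩ V)) :=
      isCompact_Icc.prod ((isCompact_closedBall _ _).inter_right V.closed_of_finiteDimensional)
    have hmaps : MapsTo Prod.fst (Icc (0 : ℝ) T ×ˢ (Metric.closedBall (0 : 𝔸) R ∩ V)) (Icc 0 T) :=
      fun p hp => hp.1
    have hFc' := hFc.comp continuousOn_fst hmaps
    have hUc' := hU.comp continuousOn_fst hmaps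
    have hexp := continuous_exp 𝔸
    have hZ := hB.isClosed.isClosed_le (f := fun p : ℝ × 𝔸 => q p.2)
      (g := fun p => F p.1 + ε * p.1) (by fun_prop)
      (hFc'.add (continuous_const.mul continuous_fst).continuousOn)
    have hZ' := hB.isClosed.isClosed_le (f := fun p : ℝ × 𝔸 => ‖exp p.2 - U p.1‖)
      (g := fun p => ε * p.1)
      (((hexp.comp continuous_snd).continuousOn.sub hUc').norm) (by fun_prop)
    have hcomp := (hB.of_isClosed_subset (hZ.inter hZ') (fun p hp => hp.1.1)).image continuous_fst
    convert hcomp.isClosed using 1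
    ext t
    constructor
    · rintro ⟨⟨z, hz, h1, h2, h3⟩, ht⟩
      have hm : (t, z) ∈ Icc (0 : ℝ) T ×ˢ (Metric.closedBall (0 : 𝔸) R ∩ V) :=
        ⟨ht, by simpa using h1, hz⟩
      exact ⟨(t, z), ⟨⟨hm, h2⟩, hm, h3⟩, rfl⟩
    · rintro ⟨⟨t, z⟩, ⟨⟨hm, h2⟩, -, h3⟩, rfl⟩
      exact ⟨⟨z, hm.2.2, by simpa using hm.2.1, h2, h3⟩, hm.1⟩
  · refine hred 0 h0T 0 V.zero_mem ?_ ?_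
    · have := hqs 0 0 le_rfl
      rw [zero_smul, zero_mul] at this
      simp [hF, this]
    · simp [exp_zero, hU0]
  · rintro t ⟨⟨z, hz, -, hzq, hzU⟩, ht⟩ y hy
    obtain ⟨l, hl⟩ := hG.2.1 t ht
    have hlV : l ∈ V := V.closed_of_finiteDimensional.mem_of_tendsto hl (Eventually.of_forall hGV)
    have hUd := hasDerivWithinAt_Ici_of_tendsto_generator hU hS hd ht hl
    have hE : HasDerivWithinAt (fun s => exp ((s - t) • l) * U t - U s) 0 (Ici t) t := by
      have h1 : HasDerivAt (fun s : ℝ => exp ((s - t) • l)) l t := by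
        have := (hasDerivAt_exp_smul_const l (t - t)).comp_sub_const t t
        simpa [exp_zero] using this
      exact ((h1.mul_const (U t)).hasDerivWithinAt.fun_sub hUd).congr_deriv (sub_self _)
    have hEo := (hasDerivWithinAt_iff_isLittleO.1 hE).def hε
    have ev1 : ∀ᶠ s in 𝓝[>] t, ‖exp ((s - t) • l) * U t - U s‖ ≤ ε * (s - t) := by
      filter_upwards [hEo.filter_mono (nhdsWithin_mono _ Ioi_subset_Ici_self),
        self_mem_nhdsWithin] with s h1 h2
      have h2 : t < s := h2
      simpa [exp_zero, abs_of_pos (sub_pos.2 h2)] using h1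
    have ev2 : ∀ᶠ s in 𝓝[>] t, q l - ε < q (G s) :=
      ((hq.tendsto l).comp hl).eventually (lt_mem_nhds (by linarith))
    obtain ⟨b, hb, hbq⟩ := mem_nhdsGT_iff_exists_Ioo_subset.1 ev2
    have hb : t < b := hb
    have hy : t < y := hy
    obtain ⟨s, hsU, hs1, hs2⟩ := (ev1.and
      (Ioo_mem_nhdsGT (lt_min ht.2 (lt_min hb hy)))).exists
    have hsT : s < T := hs2.trans_le (min_le_left _ _)
    have hsb : s < b := hs2.trans_le ((min_le_right _ _).trans (min_le_left _ _))
    have hsy : s < y := hs2.trans_le ((min_le_right _ _).trans (min_le_right _ _))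
    have hsI : s ∈ Icc 0 T := ⟨ht.1.trans hs1.le, hsT.le⟩
    have htI : t ∈ Icc 0 T := ⟨ht.1, ht.2.le⟩
    refine ⟨s, ?_, hs1, hsy.le⟩
    have hFs : F t + (s - t) * (q l - ε) ≤ F s := by
      have h1 := intervalIntegral.integral_add_adjacent_intervals (hii 0 h0T t htI)
        (hii t htI s hsI)
      have h2 : ∫ _ in t..s, (q l - ε) ≤ ∫ r in t..s, q (G r) :=
        intervalIntegral.integral_mono_on_of_le_Ioo hs1.le (by simp) (hii t htI s hsI)
          fun r hr => (hbq ⟨hr.1, hr.2.trans hsb⟩ : q l - ε < q (G r)).le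
      rw [intervalIntegral.integral_const, smul_eq_mul] at h2
      simp only [hF]
      linarith
    have hδ : (s - t) • l ∈ V := V.smul_mem _ hlV
    obtain ⟨w, hw, hwe, hwq⟩ := hmul _ hδ z hz
    rw [hqs _ _ (sub_nonneg.2 hs1.le)] at hwq
    refine hred s hsI w hw (by linarith) ?_
    rw [hwe]
    calc ‖exp ((s - t) • l) * exp z - U s‖
        = ‖exp ((s - t) • l) * (exp z - U t) + (exp ((s - t) • l) * U t - U s)‖ := by
          rw [mul_sub, sub_add_sub_cancel]
      _ ≤ ‖exp z - U t‖ + ‖exp ((s - t) • l) * U t - U s‖ :=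
          (norm_add_le _ _).trans (add_le_add_left (hiso _ hδ _) _)
      _ ≤ ε * t + ε * (s - t) := add_le_add hzU hsU
      _ = ε * s := by ring

/-- The value at time `T` of the solution of `U' = G U` is the exponential of an element of `V` of
length at most `∫ q (G t)`. -/
theorem exists_exp_eq_evolution {q : 𝔸 → ℝ} (hq : Continuous q) (hq0 : ∀ x, 0 ≤ q x)
    (hqs : ∀ (c : ℝ) (x : 𝔸), 0 ≤ c → q (c • x) = c * q x)
    (hmul : ∀ x ∈ V, ∀ y ∈ V, ∃ z ∈ V, exp z = exp x * exp y ∧ q z ≤ q x + q y)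
    {K : ℝ} (hK : 0 ≤ K)
    (hbd : ∀ z ∈ V, ∃ w ∈ V, exp w = exp z ∧ q w ≤ q z ∧ ‖w‖ ≤ K * (1 + q z))
    (hiso : ∀ a ∈ V, ∀ x, ‖exp a * x‖ ≤ ‖x‖)
    {G U : ℝ → 𝔸} {T : ℝ} (hT : 0 ≤ T) (hG : PiecewiseContinuousOn G 0 T) (hGV : ∀ t, G t ∈ V)
    (hU : ContinuousOn U (Icc 0 T)) {S : Set ℝ} (hS : S.Finite)
    (hd : ∀ t ∈ Icc 0 T \ S, HasDerivWithinAt U (G t * U t) (Icc 0 T) t) (hU0 : U 0 = 1) :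
    ∃ z ∈ V, exp z = U T ∧ q z ≤ ∫ t in (0 : ℝ)..T, q (G t) := by
  have : ProperSpace 𝔸 := FiniteDimensional.proper ℝ 𝔸
  set I := ∫ t in (0 : ℝ)..T, q (G t) with hI
  choose z hzV hzn hzq hzU using fun n : ℕ => exists_exp_near_evolution hq hq0 hqs hmul hK hbd hiso
    hT hG hGV hU hS hd hU0 (Nat.one_div_pos_of_nat (n := n) : (0 : ℝ) < 1 / ((n : ℝ) + 1))
  have hcomp : IsCompact (Metric.closedBall (0 : 𝔸) (K * (1 + (I + T))) ∩ V) :=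
    (isCompact_closedBall _ _).inter_right V.closed_of_finiteDimensional
  obtain ⟨w, hw, φ, hφ, hlim⟩ := hcomp.tendsto_subseq (x := z) (by
    intro n
    refine ⟨?_, hzV n⟩
    rw [mem_closedBall_zero_iff]
    refine (hzn n).trans ?_
    have h1 : 1 / ((n : ℝ) + 1) ≤ 1 := by
      rw [div_le_one (by positivity)]
      linarith [Nat.cast_nonneg (α := ℝ) n]
    have h2 : 1 / ((n : ℝ) + 1) * T ≤ T := by nlinarith
    gcongr)
  have herr : Tendsto (fun n => 1 / ((φ n : ℝ) + 1) * T) atTop (𝓝 0) := by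
    simpa using (tendsto_one_div_add_atTop_nhds_zero_nat (𝕜 := ℝ).comp hφ.tendsto_atTop).mul_const T
  refine ⟨w, hw.2, ?_, ?_⟩
  · have h1 : Tendsto (fun n => ‖exp (z (φ n)) - U T‖) atTop (𝓝 ‖exp w - U T‖) :=
      ((((continuous_exp 𝔸).tendsto w).comp hlim).sub_const _).norm
    have h2 := le_of_tendsto_of_tendsto' h1 herr fun n => hzU (φ n)
    exact sub_eq_zero.1 (norm_le_zero_iff.1 h2)
  · have h1 : Tendsto (fun n => q (z (φ n))) atTop (𝓝 (q w)) := (hq.tendsto w).comp hlim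
    have h2 := le_of_tendsto_of_tendsto' h1 (herr.const_add I) fun n => hzq (φ n)
    simpa using h2

end Evolution

end QuantumControl

/-! ### The covariance form on matrices, and splitting off scalars. -/

namespace QuantumControl

section MatrixEvolution

open NormedSpace
open scoped Matrix.Norms.L2Operator ComplexOrder

variable {D : ℕ}

/-- The operator norm makes the complex matrices a real normed algebra. -/
@[reducible]
noncomputable def matrixRealNormedAlgebra (D : ℕ) :
    NormedAlgebra ℝ (Matrix (Fin D) (Fin D) ℂ) :=
  { (inferInstance : Algebra ℝ (Matrix (Fin D) (Fin D) ℂ)) with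
    norm_smul_le := fun r x => by
      have h : r • x = (r : ℂ) • x := by ext i j; simp
      rw [h, norm_smul, Complex.norm_real] }

attribute [local instance] matrixRealNormedAlgebra

theorem real_smul_matrix (r : ℝ) (x : Matrix (Fin D) (Fin D) ℂ) : r • x = (r : ℂ) • x := by
  ext i j
  simp

/-- The covariance form `re ((tr x / D) (tr y / D) - tr (x y) / D)`. On skew-Hermitian matrices it
is positive semidefinite, and `covForm D (i A) (i A) = (dev A)²`. -/
noncomputable def covForm (D : ℕ) :
    Matrix (Fin D) (Fin D) ℂ →L[ℝ] Matrix (Fin D) (Fin D) ℂ →L[ℝ] ℝ :=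
  LinearMap.toContinuousBilinearMap (LinearMap.mk₂ ℝ
    (fun x y => ((x.trace / D) * (y.trace / D) - (x * y).trace / D).re)
    (fun x x' y => by
      rw [← Complex.add_re, Matrix.trace_add, add_mul, Matrix.trace_add]; congr 1; ring)
    (fun c x y => by
      rw [real_smul_matrix, Matrix.smul_mul, Matrix.trace_smul, Matrix.trace_smul, smul_eq_mul,
        smul_eq_mul, smul_eq_mul, ← Complex.re_ofReal_mul]
      congr 1; ring)
    (fun x y y' => by
      rw [← Complex.add_re, Matrix.trace_add, mul_add, Matrix.trace_add]; congr 1; ring)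
    (fun c x y => by
      rw [real_smul_matrix, Matrix.mul_smul, Matrix.trace_smul, Matrix.trace_smul, smul_eq_mul,
        smul_eq_mul, smul_eq_mul, ← Complex.re_ofReal_mul]
      congr 1; ring))

theorem covForm_apply (x y : Matrix (Fin D) (Fin D) ℂ) :
    covForm D x y = ((x.trace / D) * (y.trace / D) - (x * y).trace / D).re := rfl

theorem covForm_symm (x y : Matrix (Fin D) (Fin D) ℂ) : covForm D x y = covForm D y x := by
  rw [covForm_apply, covForm_apply, Matrix.trace_mul_comm x y, mul_comm (x.trace / (D : ℂ))]

theorem covForm_conj (u v x y : Matrix (Fin D) (Fin D) ℂ) (hvu : v * u = 1) :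
    covForm D (u * x * v) (u * y * v) = covForm D x y := by
  have ht : ∀ z : Matrix (Fin D) (Fin D) ℂ, (u * z * v).trace = z.trace := fun z => by
    rw [Matrix.trace_mul_comm, ← mul_assoc, hvu, one_mul]
  have hm : u * x * v * (u * y * v) = u * (x * y) * v := by
    calc u * x * v * (u * y * v) = u * x * (v * u) * y * v := by simp only [mul_assoc]
      _ = u * (x * y) * v := by rw [hvu, mul_one, mul_assoc u x y]
  rw [covForm_apply, covForm_apply, hm, ht, ht, ht]

/-- The length of a skew-Hermitian matrix: the deviation of the corresponding Hermitian one. -/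
noncomputable def devNorm (x : Matrix (Fin D) (Fin D) ℂ) : ℝ := √(covForm D x x)

theorem continuous_devNorm : Continuous (devNorm : Matrix (Fin D) (Fin D) ℂ → ℝ) :=
  ((covForm D).continuous.clm_apply continuous_id).sqrt

theorem devNorm_nonneg (x : Matrix (Fin D) (Fin D) ℂ) : 0 ≤ devNorm x := Real.sqrt_nonneg _

theorem devNorm_smul (c : ℝ) (x : Matrix (Fin D) (Fin D) ℂ) (hc : 0 ≤ c) :
    devNorm (c • x) = c * devNorm x := by
  simp only [devNorm, map_smul, smul_apply, smul_eq_mul]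
  rw [← mul_assoc, ← pow_two, Real.sqrt_mul (sq_nonneg c), Real.sqrt_sq hc]

theorem devNorm_neg_I_smul (A : Matrix (Fin D) (Fin D) ℂ) :
    devNorm ((-Complex.I) • A) = dev A := by
  rw [devNorm, dev, covForm_apply]
  congr 2
  simp only [Matrix.smul_mul, Matrix.mul_smul, Matrix.trace_smul, smul_eq_mul]
  linear_combination ((A.trace / D) ^ 2 - (A * A).trace / D) * Complex.I_sq

theorem trace_scalar_div (hD : D ≠ 0) (c : ℂ) :
    (c • (1 : Matrix (Fin D) (Fin D) ℂ)).trace / D = c := by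
  have : (D : ℂ) ≠ 0 := Nat.cast_ne_zero.2 hD
  simp [Matrix.trace_smul, this]

theorem devNorm_add_scalar (hD : D ≠ 0) (x : Matrix (Fin D) (Fin D) ℂ) (c : ℂ) :
    devNorm (x + c • 1) = devNorm x := by
  have hD' : (D : ℂ) ≠ 0 := Nat.cast_ne_zero.2 hD
  have h1 : (x + c • 1).trace / D = x.trace / D + c := by
    rw [Matrix.trace_add, add_div, trace_scalar_div hD]
  have h2 : ((x + c • 1) * (x + c • 1)).trace / (D : ℂ)
      = (x * x).trace / D + 2 * c * (x.trace / D) + c ^ 2 := by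
    simp only [add_mul, mul_add, Matrix.trace_add, Matrix.smul_mul, Matrix.mul_smul, one_mul,
      mul_one, Matrix.trace_smul, Matrix.trace_one, Fintype.card_fin, smul_eq_mul]
    field_simp
    ring
  rw [devNorm, devNorm, covForm_apply, covForm_apply, h1, h2]
  congr 2
  ring

theorem trace_div_eq_mul_I {x : Matrix (Fin D) (Fin D) ℂ} (hx : star x = -x) :
    ∃ θ : ℝ, x.trace / D = θ * Complex.I := by
  have h1 : star x.trace = -x.trace := by
    rw [← Matrix.trace_conjTranspose, ← Matrix.star_eq_conjTranspose, hx, Matrix.trace_neg]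
  have h2 : x.trace.re = 0 := by
    have := congrArg Complex.re h1
    simp only [Complex.star_def, Complex.conj_re, Complex.neg_re] at this
    linarith
  refine ⟨x.trace.im / D, ?_⟩
  apply Complex.ext
  · simp [h2]
  · simp

/-- Subtracting the mean leaves the form unchanged, and on a traceless skew-Hermitian z it equals
tr(z* z)/D, which vanishes only at z = 0. -/
theorem exists_eq_scalar_of_covForm_le (hD : D ≠ 0) {x : Matrix (Fin D) (Fin D) ℂ}
    (hx : star x = -x) (h : covForm D x x ≤ 0) : x = (x.trace / D) • 1 := by
  have hD' : (0 : ℝ) < D := Nat.cast_pos.2 (Nat.pos_of_ne_zero hD)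
  obtain ⟨θ, hθ⟩ := trace_div_eq_mul_I hx
  set c := x.trace / (D : ℂ) with hc
  set z := x - c • 1 with hz
  have hzs : star z = -z := by
    rw [hz, star_sub, hx, star_smul, star_one, hθ]
    simp only [star_mul', Complex.star_def, Complex.conj_ofReal, Complex.conj_I]
    module
  have hzt : z.trace / D = 0 := by
    rw [hz, Matrix.trace_sub, sub_div, trace_scalar_div hD, ← hc, sub_self]
  have hform : covForm D z z = (Matrix.trace (z.conjTranspose * z)).re / D := by
    rw [covForm_apply, hzt, ← Matrix.star_eq_conjTranspose, hzs, Matrix.neg_mul,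
      Matrix.trace_neg, zero_mul, zero_sub, ← neg_div]
    exact Complex.div_natCast_re _ _
  have hp := (Matrix.posSemidef_conjTranspose_mul_self z).trace_nonneg
  have hshift : devNorm x = devNorm z := by
    rw [hz, sub_eq_add_neg, ← neg_smul, devNorm_add_scalar hD]
  have hz0 : covForm D z z ≤ 0 := by
    rw [← Real.sqrt_eq_zero']
    exact hshift.symm.trans (Real.sqrt_eq_zero'.2 h)
  have hre : (Matrix.trace (z.conjTranspose * z)).re ≤ 0 := by
    rw [hform] at hz0
    by_contra hcon
    exact absurd hz0 (not_le.2 (div_pos (not_le.1 hcon) hD'))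
  have htr : Matrix.trace (z.conjTranspose * z) = 0 := by
    obtain ⟨h1, h2⟩ := Complex.nonneg_iff.1 hp
    exact Complex.ext (le_antisymm hre h1) h2.symm
  exact sub_eq_zero.1 (Matrix.trace_conjTranspose_mul_self_eq_zero_iff.1 htr)

theorem exp_add_scalar (x : Matrix (Fin D) (Fin D) ℂ) (c : ℂ) :
    exp (x + c • 1) = Complex.exp c • exp x := by
  let _ : NormedAlgebra ℚ (Matrix (Fin D) (Fin D) ℂ) := NormedAlgebra.restrictScalars ℚ ℝ _
  have h1 : exp (c • (1 : Matrix (Fin D) (Fin D) ℂ)) = Complex.exp c • 1 := by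
    rw [← Algebra.algebraMap_eq_smul_one, ← Algebra.algebraMap_eq_smul_one,
      ← algebraMap_exp_comm, Complex.exp_eq_exp_ℂ]
  rw [exp_add_of_commute ((Commute.one_right x).smul_right c), h1, mul_smul_comm, mul_one]

section Subalgebra

variable {V : Submodule ℝ (Matrix (Fin D) (Fin D) ℂ)}

/-- The exponential of a skew-Hermitian matrix is unitary. This keeps earlier errors from growing
along the evolution. -/
theorem norm_exp_mul_le (hskew : ∀ x ∈ V, star x = -x) {a : Matrix (Fin D) (Fin D) ℂ} (ha : a ∈ V)
    (x : Matrix (Fin D) (Fin D) ℂ) : ‖exp a * x‖ ≤ ‖x‖ := by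
  let _ : NormedAlgebra ℚ (Matrix (Fin D) (Fin D) ℂ) := NormedAlgebra.restrictScalars ℚ ℝ _
  exact (CStarRing.norm_mem_unitary_mul x
    (exp_mem_unitary_of_mem_skewAdjoint (skewAdjoint.mem_iff.2 (hskew a ha)))).le

/-- Without scalar matrices, `covForm` is an inner product. -/
theorem covForm_pos (hD : D ≠ 0) (hskew : ∀ x ∈ V, star x = -x)
    (hscalar : ∀ c : ℂ, c • (1 : Matrix (Fin D) (Fin D) ℂ) ∈ V → c = 0) :
    ∀ x ∈ V, x ≠ 0 → 0 < covForm D x x := by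
  intro x hx hx0
  by_contra hcon
  have h1 := exists_eq_scalar_of_covForm_le hD (hskew x hx) (not_lt.1 hcon)
  have h2 := hscalar (x.trace / D) (h1 ▸ hx)
  rw [h2, zero_smul] at h1
  exact hx0 h1

theorem exists_exp_mul_of_no_scalar (hD : D ≠ 0) (hV : ∀ x ∈ V, ∀ y ∈ V, x * y - y * x ∈ V)
    (hskew : ∀ x ∈ V, star x = -x)
    (hscalar : ∀ c : ℂ, c • (1 : Matrix (Fin D) (Fin D) ℂ) ∈ V → c = 0) :
    (∀ x ∈ V, ∀ y ∈ V, ∃ z ∈ V, exp z = exp x * exp y ∧ devNorm z ≤ devNorm x + devNorm y) ∧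
    ∃ K, 0 ≤ K ∧ ∀ z ∈ V, ‖z‖ ≤ K * devNorm z := by
  have hpos := covForm_pos hD hskew hscalar
  refine ⟨fun x hx y hy => exists_exp_eq_exp_mul_exp hV (covForm D) covForm_symm
    (fun u v x y _ hvu => covForm_conj u v x y hvu) hpos hx hy, ?_⟩
  obtain ⟨c, hc, hle⟩ := exists_quadratic_lower_bound (covForm D) hpos
  refine ⟨(√c)⁻¹, by positivity, fun z hz => ?_⟩
  have h1 := Real.sqrt_le_sqrt (hle z hz)
  rw [Real.sqrt_mul hc.le, Real.sqrt_sq (norm_nonneg z)] at h1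
  rwa [le_inv_mul_iff₀ (Real.sqrt_pos.2 hc)]

/-- In a Lie algebra of skew-Hermitian matrices, products of exponentials are exponentials, with
exponents controlled in length and in norm. -/
theorem exists_exp_mul (hD : D ≠ 0) (hV : ∀ x ∈ V, ∀ y ∈ V, x * y - y * x ∈ V)
    (hskew : ∀ x ∈ V, star x = -x) :
    (∀ x ∈ V, ∀ y ∈ V, ∃ z ∈ V, exp z = exp x * exp y ∧ devNorm z ≤ devNorm x + devNorm y) ∧
    ∃ K, 0 ≤ K ∧ ∀ z ∈ V, ∃ w ∈ V, exp w = exp z ∧ devNorm w ≤ devNorm z ∧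
      ‖w‖ ≤ K * (1 + devNorm z) := by
  by_cases hI : Complex.I • (1 : Matrix (Fin D) (Fin D) ℂ) ∈ V
  · have hIθ : ∀ θ : ℝ, ((θ : ℂ) * Complex.I) • (1 : Matrix (Fin D) (Fin D) ℂ) ∈ V := by
      intro θ
      rw [mul_smul, ← real_smul_matrix]
      exact V.smul_mem θ hI
    let W : Submodule ℝ (Matrix (Fin D) (Fin D) ℂ) :=
      -- Commutators are traceless, so the traceless part of `V` is again closed under them, and it
      -- contains no nonzero scalar.
      V ⊓ LinearMap.ker (Matrix.traceLinearMap (Fin D) ℝ ℂ)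
    have hW : ∀ z, z ∈ W ↔ z ∈ V ∧ z.trace = 0 := fun z => Iff.rfl
    have hsplit : ∀ x ∈ V, ∃ w ∈ W, ∃ θ : ℝ, x = w + ((θ : ℂ) * Complex.I) • 1 := by
      intro x hx
      obtain ⟨θ, hθ⟩ := trace_div_eq_mul_I (hskew x hx)
      refine ⟨x - ((θ : ℂ) * Complex.I) • 1, (hW _).2 ⟨V.sub_mem hx (hIθ θ), ?_⟩, θ, by abel⟩
      have hD' : (D : ℂ) ≠ 0 := Nat.cast_ne_zero.2 hD
      have h1 : (x - ((θ : ℂ) * Complex.I) • 1).trace / (D : ℂ) = 0 := by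
        rw [Matrix.trace_sub, sub_div, trace_scalar_div hD, hθ, sub_self]
      exact (div_eq_zero_iff.1 h1).resolve_right hD'
    obtain ⟨hmul, K, hK, hbound⟩ := exists_exp_mul_of_no_scalar (V := W) hD
      (fun x hx y hy => (hW _).2 ⟨hV x hx.1 y hy.1, by
        rw [Matrix.trace_sub, Matrix.trace_mul_comm, sub_self]⟩)
      (fun x hx => hskew x hx.1)
      (fun c hc => by
        have h1 := trace_scalar_div hD c
        rw [((hW _).1 hc).2, zero_div] at h1
        exact h1.symm)
    refine ⟨?_, K + 2 * Real.pi * ‖(1 : Matrix (Fin D) (Fin D) ℂ)‖, by positivity, ?_⟩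
    · intro x hx y hy
      obtain ⟨x', hx', θ, rfl⟩ := hsplit x hx
      obtain ⟨y', hy', η, rfl⟩ := hsplit y hy
      obtain ⟨z, hz, hze, hzq⟩ := hmul x' hx' y' hy'
      refine ⟨z + (((θ + η : ℝ) : ℂ) * Complex.I) • 1, V.add_mem hz.1 (hIθ _), ?_, ?_⟩
      · rw [exp_add_scalar, exp_add_scalar, exp_add_scalar, hze, smul_mul_assoc, mul_smul_comm,
          smul_smul, ← Complex.exp_add]
        congr 2
        push_cast
        ring
      · simpa only [devNorm_add_scalar hD] using hzq
    · intro z hz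
      obtain ⟨z', hz', θ, rfl⟩ := hsplit z hz
      have h2π : (0 : ℝ) < 2 * Real.pi := by positivity
      -- The deviation does not control the scalar part; reducing the phase modulo 2π keeps the
      -- exponential and bounds the norm.
      set η : ℝ := toIcoMod h2π 0 θ with hη
      have hη0 : η ∈ Ico 0 (0 + 2 * Real.pi) := toIcoMod_mem_Ico h2π 0 θ
      refine ⟨z' + ((η : ℂ) * Complex.I) • 1, V.add_mem hz'.1 (hIθ _), ?_, ?_, ?_⟩
      · rw [exp_add_scalar, exp_add_scalar]
        congr 1
        rw [Complex.exp_eq_exp_iff_exists_int]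
        refine ⟨-toIcoDiv h2π 0 θ, ?_⟩
        have h3 := self_sub_toIcoDiv_zsmul h2π 0 θ
        rw [← hη, zsmul_eq_mul] at h3
        rw [← h3]
        push_cast
        ring
      · rw [devNorm_add_scalar hD, devNorm_add_scalar hD]
      · rw [devNorm_add_scalar hD]
        have h4 : ‖((η : ℂ) * Complex.I) • (1 : Matrix (Fin D) (Fin D) ℂ)‖
            ≤ 2 * Real.pi * ‖(1 : Matrix (Fin D) (Fin D) ℂ)‖ := by
          rw [norm_smul, norm_mul, Complex.norm_I, mul_one, Complex.norm_real,
            Real.norm_of_nonneg hη0.1]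
          have := hη0.2
          gcongr
          linarith
        have h5 := hbound z' hz'
        have h6 := devNorm_nonneg z'
        have h7 : 0 ≤ 2 * Real.pi * ‖(1 : Matrix (Fin D) (Fin D) ℂ)‖ := by positivity
        calc ‖z' + ((η : ℂ) * Complex.I) • 1‖
            ≤ K * devNorm z' + 2 * Real.pi * ‖(1 : Matrix (Fin D) (Fin D) ℂ)‖ :=
              (norm_add_le _ _).trans (add_le_add h5 h4)
          _ ≤ (K + 2 * Real.pi * ‖(1 : Matrix (Fin D) (Fin D) ℂ)‖) * (1 + devNorm z') := by
              nlinarith [mul_nonneg h7 h6]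
  -- A scalar in `V` is skew-Hermitian, hence a real multiple of i·1; a nonzero one would put i·1 in
  -- `V`.
  · have hscalar : ∀ c : ℂ, c • (1 : Matrix (Fin D) (Fin D) ℂ) ∈ V → c = 0 := by
      intro c hc
      obtain ⟨θ, hθ⟩ := trace_div_eq_mul_I (hskew _ hc)
      rw [trace_scalar_div hD] at hθ
      by_contra hc0
      have hθ0 : θ ≠ 0 := by
        rintro rfl
        exact hc0 (by simpa using hθ)
      apply hI
      have h1 := V.smul_mem θ⁻¹ hc
      rw [hθ, real_smul_matrix, smul_smul, ← mul_assoc, ← Complex.ofReal_mul,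
        inv_mul_cancel₀ hθ0, Complex.ofReal_one, one_mul] at h1
      exact h1
    obtain ⟨hmul, K, hK, hbound⟩ := exists_exp_mul_of_no_scalar hD hV hskew hscalar
    refine ⟨hmul, K, hK, fun z hz => ⟨z, hz, rfl, le_rfl, (hbound z hz).trans ?_⟩⟩
    gcongr
    linarith

/-- Solutions of the Schrödinger equation with `i H` in a Lie algebra of skew-Hermitian matrices. -/
theorem exists_exp_eq_schrodinger (hD : D ≠ 0) (hV : ∀ x ∈ V, ∀ y ∈ V, x * y - y * x ∈ V)
    (hskew : ∀ x ∈ V, star x = -x) {H U : ℝ → Matrix (Fin D) (Fin D) ℂ} {T : ℝ} (hT : 0 ≤ T)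
    (hH : PiecewiseContinuousOn H 0 T) (hHV : ∀ t, (-Complex.I) • H t ∈ V)
    (hU : IsSchrodingerSolution H U T) :
    ∃ z ∈ V, exp z = U T ∧ devNorm z ≤ ∫ t in (0 : ℝ)..T, dev (H t) := by
  obtain ⟨hmul, K, hK, hbd⟩ := exists_exp_mul hD hV hskew
  obtain ⟨S, hS, hd⟩ := hU.equation
  have h := exists_exp_eq_evolution (V := V) (q := devNorm) continuous_devNorm devNorm_nonneg
    devNorm_smul hmul hK hbd (fun a ha x => norm_exp_mul_le hskew ha x)
    (G := fun t => (-Complex.I) • H t) (U := U) hT (hH.comp (continuous_const_smul _)) hHV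
    hU.continuousOn hS (fun t ht => by
      have h1 := hd t ht
      rw [← smul_mul_assoc] at h1
      exact h1) hU.initial
  simpa only [devNorm_neg_I_smul] using h

end Subalgebra

end MatrixEvolution

end QuantumControl

end

/-! ### The dynamical Lie algebra and the conclusion. -/

namespace QuantumControl

/-- The skew-Hermitian matrices. -/
def skewHermitian (D : ℕ) : LieSubalgebra ℝ (Matrix (Fin D) (Fin D) ℂ) where
  carrier := {x | star x = -x}
  add_mem' := fun {x y} hx hy => by
    change star (x + y) = -(x + y)
    rw [star_add, hx, hy, neg_add]
  zero_mem' := by simp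
  smul_mem' := fun c x hx => by
    change star (c • x) = -(c • x)
    rw [star_smul, hx, star_trivial, smul_neg]
  lie_mem' := fun {x y} hx hy => by
    change star (x * y - y * x) = -(x * y - y * x)
    rw [star_sub, star_mul, star_mul, hx, hy, neg_mul_neg, neg_mul_neg, neg_sub]

theorem star_eq_neg_of_mem_dynamicalLieAlgebra {D M : ℕ}
    {Hm : Fin (M + 1) → Matrix (Fin D) (Fin D) ℂ} (hHm : ∀ m, (Hm m).IsHermitian)
    {x : Matrix (Fin D) (Fin D) ℂ} (hx : x ∈ dynamicalLieAlgebra Hm) : star x = -x := by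
  have h : dynamicalLieAlgebra Hm ≤ skewHermitian D := by
    refine LieSubalgebra.lieSpan_le.2 ?_
    rintro _ ⟨m, rfl⟩
    change star (Complex.I • Hm m) = -(Complex.I • Hm m)
    rw [star_smul, Matrix.star_eq_conjTranspose, hHm m, Complex.star_def, Complex.conj_I, neg_smul]
  exact h hx

theorem neg_I_smul_hamiltonian_mem {D M : ℕ} (Hm : Fin (M + 1) → Matrix (Fin D) (Fin D) ℂ)
    (h : Fin (M + 1) → ℝ → ℝ) (t : ℝ) :
    (-Complex.I) • hamiltonian Hm h t ∈ dynamicalLieAlgebra Hm := by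
  have h1 : (-Complex.I) • hamiltonian Hm h t = ∑ m, (-h m t) • (Complex.I • Hm m) := by
    rw [hamiltonian, Finset.smul_sum]
    refine Finset.sum_congr rfl fun m _ => ?_
    rw [smul_comm, neg_smul, neg_smul, smul_neg]
  rw [h1]
  exact (dynamicalLieAlgebra Hm).toSubmodule.sum_mem fun m _ =>
    (dynamicalLieAlgebra Hm).smul_mem _ (LieSubalgebra.subset_lieSpan (mem_range_self m))

end QuantumControl

theorem corollary2 {D M : ℕ}
    (Hm : Fin (M + 1) → Matrix (Fin D) (Fin D) ℂ) (hHm : ∀ m, (Hm m).IsHermitian)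
    (h : Fin (M + 1) → ℝ → ℝ) (T : ℝ) (hT : 0 ≤ T)
    (hH : QuantumControl.PiecewiseContinuousOn (QuantumControl.hamiltonian Hm h) 0 T)
    (U : ℝ → Matrix (Fin D) (Fin D) ℂ)
    (hU : QuantumControl.IsSchrodingerSolution (QuantumControl.hamiltonian Hm h) U T) :
    ∃ C : Matrix (Fin D) (Fin D) ℂ,
      C.IsHermitian ∧
      NormedSpace.exp ((-Complex.I) • C) = U T ∧
      Complex.I • C ∈ QuantumControl.dynamicalLieAlgebra Hm ∧
      QuantumControl.dev C ≤
        ∫ t in (0 : ℝ)..T, QuantumControl.dev (QuantumControl.hamiltonian Hm h t) := by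
  open QuantumControl in
  rcases Nat.eq_zero_or_pos D with rfl | hD
  · refine ⟨0, Subsingleton.elim _ _, Subsingleton.elim _ _, ?_, ?_⟩
    · rw [smul_zero]
      exact (dynamicalLieAlgebra Hm).zero_mem
    · have h0 : dev (0 : Matrix (Fin 0) (Fin 0) ℂ) = 0 := by simp [dev]
      rw [h0]
      exact intervalIntegral.integral_nonneg hT fun t _ => Real.sqrt_nonneg _
  · let V : Submodule ℝ (Matrix (Fin D) (Fin D) ℂ) :=
      { carrier := {x | x ∈ dynamicalLieAlgebra Hm}
        add_mem' := fun hx hy => (dynamicalLieAlgebra Hm).add_mem hx hy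
        zero_mem' := (dynamicalLieAlgebra Hm).zero_mem
        smul_mem' := fun c _ hx => (dynamicalLieAlgebra Hm).smul_mem c hx }
    obtain ⟨z, hzV, hze, hzq⟩ := exists_exp_eq_schrodinger (V := V) hD.ne'
      (fun x hx y hy => (dynamicalLieAlgebra Hm).lie_mem hx hy)
      (fun x hx => star_eq_neg_of_mem_dynamicalLieAlgebra hHm hx) hT hH
      (fun t => neg_I_smul_hamiltonian_mem Hm h t) hU
    have hz : (-Complex.I) • Complex.I • z = z := by
      rw [smul_smul, neg_mul, Complex.I_mul_I, neg_neg, one_smul]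
    have hzs : star z = -z := star_eq_neg_of_mem_dynamicalLieAlgebra hHm hzV
    -- C = iz, so that -iC = z and iC = -z.
    refine ⟨Complex.I • z, ?_, by rw [hz, hze], ?_, ?_⟩
    · rw [Matrix.IsHermitian, ← Matrix.star_eq_conjTranspose, star_smul, hzs, Complex.star_def,
        Complex.conj_I, neg_smul_neg]
    · rw [smul_smul, Complex.I_mul_I, neg_smul, one_smul]
      exact (dynamicalLieAlgebra Hm).neg_mem hzV
    · rw [← devNorm_neg_I_smul, hz]
      exact hzq
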